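/- Let $G$ be a connected semisimple Lie group with finite center, $K\subset G$ a maximal compact subgroup and $\Gamma\subset G$ a torsion-free uniform lattice (a discrete cocompact subgroup). Let $dg$ be a Haar measure on $G$ and let $dx$ be the finite $G$-invariant measure on the compact quotient $X=\Gamma\backslash G$ with $$\int_G f(g)\,dg=\int_X\sum_{\gamma\in\Gamma} f(\gamma x)\,dx\qquad(f\in C_c(G)).$$ Let $\chi$ be a finite-dimensional complex representation of $\Gamma$ on $V$, not necessarily unitary, and let $E=E_\chi=\Gamma\backslash(G\times V)$ be the associated flat vector bundle over $X$, where $\gamma\cdot(g,v)=(\gamma g,\chi(\gamma)v)$; write $\Gamma(g,v)$ for the class of $(g,v)$. The group $G$ acts on $E$ by $h\cdot\Gamma(g,v)=\Gamma(gh^{-1},v)$. Fix a smooth hermitian fibre metric $\langle\cdot,\cdot\rangle$ on $E$ that is $K$-invariant: $$\langle\Gamma(gk,v),\Gamma(gk,w)\rangle_{\Gamma gk}=\langle\Gamma(g,v),\Gamma(g,w)\rangle_{\Gamma g}\qquad(g\in G,\ k\in K,\ v,w\in V).$$ The space $\Gamma^\infty(X,E)$ of smooth sections is identified with $\{f\in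 C^\infty(G,V): f(\gamma g)=\chi(\gamma)f(g)\ \text{for all } \gamma\in\Gamma,\ g\in G\}$. Equip it with the scalar product $(s,t)=\int_X\langle s(x),t(x)\rangle_x\,dx$, and let $L^2(X,E)$ be its Hilbert space completion. The right regular representation $R$ of $G$ on $\Gamma^\infty(X,E)$ is $(R(h)s)(x)=h\cdot s(xh)$, that is, $(R(h)f)(g)=f(gh)$. Then: 1. The map $G\times\Gamma^\infty(X,E)\to\Gamma^\infty(X,E)$, $(h,s)\mapsto R(h)s$, is continuous for the $L^2$-topology on $\Gamma^\infty(X,E)$. 2. $R$ extends to a continuous representation of $G$ on $L^2(X,E)$, i.e. to a homomorphism, again denoted $R$, from $G$ to the group of bounded invertible operators on $L^2(X,E)$ such that $G\times L^2(X,E)\to L^2(X,E)$, $(h,u)\mapsto R(h)u$, is continuous. 3. For $k\in K$ the operator $R(k)$ on $L^2(X,E)$ is unitary. 4. For $\tau$ in the unitary dual $\widehat K$ of $K$ (the irreducible unitary representations $V_\tau$ of $K$ up to unitary equivalence) let the $K$-isotype $L^2(X,E)(\tau)$ be the sum of the images of all bounded $K$-equivariant linear maps $V_\tau\to L^2(X,E)$.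 Then every $L^2(X,E)(\tau)$ is closed and $L^2(X,E)$ is their Hilbert space direct sum: $$L^2(X,E)=\widehat{\bigoplus_{\tau\in\widehat K}}\,L^2(X,E)(\tau).$$ -/

import Mathlib

open scoped Manifold ContDiff ComplexConjugate

noncomputable section

/-! ### Lie groups -/

instance lieGroupMinSmoothness {𝔤 G : Type*} [NormedAddCommGroup 𝔤] [NormedSpace ℝ 𝔤]
    [TopologicalSpace G] [ChartedSpace 𝔤 G] [Group G] [LieGroup 𝓘(ℝ, 𝔤) ∞ G] :
    LieGroup 𝓘(ℝ, 𝔤) (minSmoothness ℝ 3) G := by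
  rw [minSmoothness_of_isRCLikeNormedField]
  infer_instance

/-- A Lie group (modelled on the vector space `𝔤`) is semisimple if its Lie algebra is. -/
def IsSemisimpleLieGroup (𝔤 G : Type*) [NormedAddCommGroup 𝔤] [NormedSpace ℝ 𝔤]
    [FiniteDimensional ℝ 𝔤] [TopologicalSpace G] [ChartedSpace 𝔤 G] [Group G]
    [LieGroup 𝓘(ℝ, 𝔤) ∞ G] : Prop :=
  haveI : CompleteSpace 𝔤 := FiniteDimensional.complete ℝ 𝔤
  LieAlgebra.IsSemisimple ℝ (GroupLieAlgebra 𝓘(ℝ, 𝔤) G)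

/-- `K` is a maximal compact subgroup of `G`. -/
def IsMaximalCompactSubgroup {G : Type*} [Group G] [TopologicalSpace G] (K : Subgroup G) : Prop :=
  Maximal (fun L : Subgroup G => IsCompact (L : Set G)) K

/-! ### The space `X = Γ \ G` and its measure -/

section Quotient

variable {G : Type*} [Group G]

/-- `X = Γ \ G`, the orbit space of the action of `Γ` on `G` by left multiplication.  It carries
the quotient topology and the quotient σ-algebra; for a discrete subgroup `Γ` of a second countable
group with its Borel sets the latter is the Borel σ-algebra. -/
abbrev LeftQuotient (Γ : Subgroup G) : Type _ := MulAction.orbitRel.Quotient Γ G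

/-- The projection `g ↦ Γ g`. -/
def LeftQuotient.proj (Γ : Subgroup G) (g : G) : LeftQuotient Γ :=
  Quotient.mk (MulAction.orbitRel Γ G) g

theorem LeftQuotient.proj_smul (Γ : Subgroup G) (γ : Γ) (g : G) :
    LeftQuotient.proj Γ ((γ : G) * g) = LeftQuotient.proj Γ g :=
  Quotient.sound (s := MulAction.orbitRel Γ G) ⟨γ, rfl⟩

theorem LeftQuotient.exists_of_proj_eq {Γ : Subgroup G} {g g' : G}
    (h : LeftQuotient.proj Γ g = LeftQuotient.proj Γ g') : ∃ γ : Γ, (γ : G) * g' = g :=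
  Quotient.exact (s := MulAction.orbitRel Γ G) h

/-- The right translation `Γ g ↦ Γ g h` of `Γ \ G`. -/
def LeftQuotient.translate {Γ : Subgroup G} (h : G) (x : LeftQuotient Γ) : LeftQuotient Γ :=
  Quotient.lift (s := MulAction.orbitRel Γ G) (fun g => LeftQuotient.proj Γ (g * h))
    (by
      rintro a b ⟨γ, rfl⟩
      change LeftQuotient.proj Γ ((γ : G) * b * h) = _
      rw [mul_assoc, LeftQuotient.proj_smul]) x

theorem LeftQuotient.continuous_proj [TopologicalSpace G] (Γ : Subgroup G) :
    Continuous (LeftQuotient.proj Γ) :=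
  continuous_quotient_mk'

instance LeftQuotient.opensMeasurableSpace [TopologicalSpace G] [MeasurableSpace G]
    [OpensMeasurableSpace G] (Γ : Subgroup G) : OpensMeasurableSpace (LeftQuotient Γ) where
  borel_le := by
    refine MeasurableSpace.generateFrom_le fun s hs => ?_
    exact (hs.preimage (LeftQuotient.continuous_proj Γ)).measurableSet

/-- `ν` is the `G`-invariant measure `dx` on `X = Γ \ G` normalized by the measure `μ = dg` on `G`:
for all `f ∈ C_c(G)`, `∫_G f(g) dg = ∫_X (∑_{γ ∈ Γ} f(γ x)) dx`. -/
structure IsQuotientMeasure [TopologicalSpace G] [MeasurableSpace G] (Γ : Subgroup G)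
    (μ : MeasureTheory.Measure G) (ν : MeasureTheory.Measure (LeftQuotient Γ)) : Prop where
  invariant : ∀ h : G, ν.map (LeftQuotient.translate h) = ν
  unfolding : ∀ f : G → ℂ, Continuous f → HasCompactSupport f →
    ∫ g, f g ∂μ = ∫ x, MulAction.automorphize (α := Γ) f x ∂ν

end Quotient

/-! ### The flat bundle `E_χ = Γ \ (G × V)` -/

section Bundle

variable {G V : Type*} [Group G] [AddCommGroup V] [Module ℂ V] {Γ : Subgroup G}

/-- The orbit relation of the action `γ • (g, v) = (γ g, χ(γ) v)` of `Γ` on `G × V`. -/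
def flatSetoid (χ : Representation ℂ Γ V) : Setoid (G × V) where
  r p q := ∃ γ : Γ, ((γ : G) * q.1, χ γ q.2) = p
  iseqv :=
    { refl := fun p => ⟨1, by simp⟩
      symm := by
        rintro p q ⟨γ, rfl⟩
        refine ⟨γ⁻¹, Prod.ext (by simp) ?_⟩
        change (χ γ⁻¹ * χ γ) q.2 = q.2
        rw [← map_mul]; simp
      trans := by
        rintro p q r ⟨γ, rfl⟩ ⟨δ, rfl⟩
        exact ⟨γ * δ, by simp [mul_assoc]⟩ }

/-- The total space of `E_χ`. -/
def FlatBundle (χ : Representation ℂ Γ V) : Type _ := Quotient (flatSetoid χ)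

namespace FlatBundle

/-- The class `Γ(g, v)`. -/
def mk (χ : Representation ℂ Γ V) (g : G) (v : V) : FlatBundle χ :=
  Quotient.mk (flatSetoid χ) (g, v)

theorem mk_smul (χ : Representation ℂ Γ V) (γ : Γ) (g : G) (v : V) :
    mk χ ((γ : G) * g) (χ γ v) = mk χ g v :=
  Quotient.sound (s := flatSetoid χ) ⟨γ, rfl⟩

theorem mk_injective (χ : Representation ℂ Γ V) (g : G) : Function.Injective (mk χ g) := by
  intro v w h
  obtain ⟨γ, hγ⟩ := Quotient.exact (s := flatSetoid χ) h
  have h1 : (γ : G) * g = g := congrArg Prod.fst hγ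
  have h2 : χ γ w = v := congrArg Prod.snd hγ
  have h3 : γ = 1 := Subtype.ext (by simpa using h1)
  rw [← h2, h3]; simp

/-- The bundle projection `E_χ → X`, `Γ(g, v) ↦ Γ g`. -/
def base {χ : Representation ℂ Γ V} (e : FlatBundle χ) : LeftQuotient Γ :=
  Quotient.lift (s := flatSetoid χ) (fun p => LeftQuotient.proj Γ p.1)
    (by rintro p q ⟨γ, rfl⟩; exact LeftQuotient.proj_smul Γ γ q.1) e

/-- The action `h • Γ(g, v) = Γ(g h⁻¹, v)` of `G` on `E_χ`. -/
def act {χ : Representation ℂ Γ V} (h : G) (e : FlatBundle χ) : FlatBundle χ :=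
  Quotient.lift (s := flatSetoid χ) (fun p => mk χ (p.1 * h⁻¹) p.2)
    (by
      rintro p q ⟨γ, rfl⟩
      change mk χ ((γ : G) * q.1 * h⁻¹) (χ γ q.2) = _
      rw [mul_assoc, mk_smul]) e

/-- The fibre of `E_χ` over `x`. -/
def Fibre (χ : Representation ℂ Γ V) (x : LeftQuotient Γ) : Type _ :=
  {e : FlatBundle χ // e.base = x}

/-- The bijection `v ↦ Γ(g, v)` of `V` with the fibre over `Γ g`, through which the fibre is a
vector space. -/
def pt (χ : Representation ℂ Γ V) (g : G) (v : V) : Fibre χ (LeftQuotient.proj Γ g) :=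
  ⟨mk χ g v, rfl⟩

end FlatBundle

end Bundle

/-! ### Smooth sections and fibre metrics -/

section Sections

variable {𝔤 G V : Type*} [NormedAddCommGroup 𝔤] [NormedSpace ℝ 𝔤]
  [TopologicalSpace G] [ChartedSpace 𝔤 G] [Group G]
  [NormedAddCommGroup V] [NormedSpace ℂ V] {Γ : Subgroup G}

variable (𝔤) in
/-- A section of `E_χ` is smooth if it has the form `Γ g ↦ Γ(g, f(g))` with `f : G → V` smooth. -/
def IsSmoothSection (χ : Representation ℂ Γ V) (s : ∀ x, FlatBundle.Fibre χ x) : Prop :=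
  ∃ f : G → V, ContMDiff 𝓘(ℝ, 𝔤) 𝓘(ℝ, V) ∞ f ∧
    ∀ g, s (LeftQuotient.proj Γ g) = FlatBundle.pt χ g (f g)

variable (𝔤) in
/-- `C^∞(G, V)^Γ`: the smooth `f : G → V` with `f(γ g) = χ(γ) f(g)`.  This is the space
`Γ^∞(X, E)` of smooth sections, see `isSmoothSection_iff`. -/
def SmoothSections (χ : Representation ℂ Γ V) : Submodule ℂ (G → V) where
  carrier := {f | ContMDiff 𝓘(ℝ, 𝔤) 𝓘(ℝ, V) ∞ f ∧ ∀ (γ : Γ) (g : G), f (γ * g) = χ γ (f g)}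
  add_mem' := by
    rintro f f' ⟨h1, h2⟩ ⟨h1', h2'⟩
    exact ⟨h1.add h1', fun γ g => by simp [h2, h2']⟩
  zero_mem' := ⟨contMDiff_const, fun γ g => by simp⟩
  smul_mem' := by
    rintro c f ⟨h1, h2⟩
    refine ⟨?_, fun γ g => by simp [h2]⟩
    exact (contDiff_const_smul (𝕜 := ℝ) (n := ∞) (F := V) c).contMDiff.comp h1

namespace SmoothSections

variable {χ : Representation ℂ Γ V}

/-- The section `Γ g ↦ Γ(g, f(g))` of `E_χ` given by `f ∈ C^∞(G, V)^Γ`. -/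
def toSection (f : SmoothSections 𝔤 χ) (x : LeftQuotient Γ) : FlatBundle.Fibre χ x :=
  ⟨Quotient.lift (s := MulAction.orbitRel Γ G) (fun g => FlatBundle.mk χ g (f.1 g))
    (by
      rintro a b ⟨γ, rfl⟩
      change FlatBundle.mk χ ((γ : G) * b) (f.1 ((γ : G) * b)) = _
      rw [f.2.2, FlatBundle.mk_smul]) x,
    by induction x using Quotient.inductionOn; rfl⟩

theorem toSection_proj (f : SmoothSections 𝔤 χ) (g : G) :
    toSection f (LeftQuotient.proj Γ g) = FlatBundle.pt χ g (f.1 g) := rfl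

/-- `f ↦ toSection f` is a bijection of `C^∞(G, V)^Γ` with the smooth sections of `E_χ`. -/
theorem isSmoothSection_iff (s : ∀ x, FlatBundle.Fibre χ x) :
    IsSmoothSection 𝔤 χ s ↔ ∃! f : SmoothSections 𝔤 χ, toSection f = s := by
  constructor
  · rintro ⟨f, hf, hs⟩
    have key : ∀ g, (s (LeftQuotient.proj Γ g)).1 = FlatBundle.mk χ g (f g) :=
      fun g => congrArg Subtype.val (hs g)
    refine ⟨⟨f, hf, fun γ g => ?_⟩, ?_, ?_⟩
    · apply FlatBundle.mk_injective χ ((γ : G) * g)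
      rw [← key, FlatBundle.mk_smul, ← key, LeftQuotient.proj_smul]
    · funext x
      induction x using Quotient.inductionOn with | _ g
      exact (hs g).symm
    · rintro f' rfl
      apply Subtype.ext
      funext g
      exact FlatBundle.mk_injective χ g (key g)
  · rintro ⟨f, rfl, -⟩
    exact ⟨f.1, f.2.1, fun g => rfl⟩

variable [LieGroup 𝓘(ℝ, 𝔤) ∞ G]

variable (𝔤 χ) in
/-- The right regular representation of `G` on smooth sections, `(R(h) f)(g) = f(g h)`. -/
def rightRegular : Representation ℂ G (SmoothSections 𝔤 χ) where
  toFun h :=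
    { toFun := fun f => ⟨fun g => f.1 (g * h),
        f.2.1.comp (contMDiff_mul_right (I := 𝓘(ℝ, 𝔤)) (n := ∞) (a := h)),
        fun γ g => by
          change f.1 ((γ : G) * g * h) = χ γ (f.1 (g * h))
          rw [mul_assoc, f.2.2]⟩
      map_add' := fun _ _ => rfl
      map_smul' := fun _ _ => rfl }
  map_one' := by ext f : 2; funext g; simp
  map_mul' h h' := by
    ext f : 2; funext g
    change f.1 (g * (h * h')) = f.1 (g * h * h')
    rw [mul_assoc]

/-- On sections of `E_χ` the right regular representation is `(R(h) s)(x) = h • s(x h)`. -/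
theorem toSection_rightRegular (h : G) (f : SmoothSections 𝔤 χ) (x : LeftQuotient Γ) :
    (toSection (rightRegular 𝔤 χ h f) x).1 =
      FlatBundle.act h (toSection f (LeftQuotient.translate h x)).1 := by
  induction x using Quotient.inductionOn with | _ g
  change FlatBundle.mk χ g (f.1 (g * h)) = FlatBundle.mk χ (g * h * h⁻¹) (f.1 (g * h))
  rw [mul_inv_cancel_right]

end SmoothSections

variable (𝔤) in
/-- A smooth hermitian fibre metric on `E_χ`; `form x` is the scalar product
`⟨·, ·⟩_x` on the fibre over `x`, conjugate linear in its first argument. -/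
structure HermitianMetric (χ : Representation ℂ Γ V) where
  form : ∀ x : LeftQuotient Γ, FlatBundle.Fibre χ x → FlatBundle.Fibre χ x → ℂ
  add_right : ∀ (g : G) (u v w : V),
    form _ (FlatBundle.pt χ g u) (FlatBundle.pt χ g (v + w)) =
      form _ (FlatBundle.pt χ g u) (FlatBundle.pt χ g v) +
        form _ (FlatBundle.pt χ g u) (FlatBundle.pt χ g w)
  smul_right : ∀ (g : G) (c : ℂ) (u v : V),
    form _ (FlatBundle.pt χ g u) (FlatBundle.pt χ g (c • v)) =
      c * form _ (FlatBundle.pt χ g u) (FlatBundle.pt χ g v)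
  conj_symm : ∀ (g : G) (u v : V),
    conj (form _ (FlatBundle.pt χ g u) (FlatBundle.pt χ g v)) =
      form _ (FlatBundle.pt χ g v) (FlatBundle.pt χ g u)
  pos : ∀ (g : G) (v : V), v ≠ 0 →
    0 < (form _ (FlatBundle.pt χ g v) (FlatBundle.pt χ g v)).re
  smooth : ContMDiff (𝓘(ℝ, 𝔤).prod (𝓘(ℝ, V).prod 𝓘(ℝ, V))) 𝓘(ℝ, ℂ) ∞
    (fun p : G × V × V => form _ (FlatBundle.pt χ p.1 p.2.1) (FlatBundle.pt χ p.1 p.2.2))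

/-- `⟨Γ(gk, v), Γ(gk, w)⟩_{Γgk} = ⟨Γ(g, v), Γ(g, w)⟩_{Γg}` for `k ∈ K`. -/
def HermitianMetric.IsInvariant {χ : Representation ℂ Γ V} (m : HermitianMetric 𝔤 χ)
    (K : Subgroup G) : Prop :=
  ∀ (g : G), ∀ k ∈ K, ∀ v w : V,
    m.form _ (FlatBundle.pt χ (g * k) v) (FlatBundle.pt χ (g * k) w) =
      m.form _ (FlatBundle.pt χ g v) (FlatBundle.pt χ g w)

/-! ### The Hilbert space `L²(X, E)` -/

theorem HermitianMetric.continuous_form {χ : Representation ℂ Γ V}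
    (m : HermitianMetric 𝔤 χ) (s t : SmoothSections 𝔤 χ) :
    Continuous fun x => m.form x (SmoothSections.toSection s x) (SmoothSections.toSection t x) := by
  have h : Continuous fun g : G =>
      m.form _ (FlatBundle.pt χ g (s.1 g)) (FlatBundle.pt χ g (t.1 g)) :=
    m.smooth.continuous.comp
      (continuous_id.prodMk (s.2.1.continuous.prodMk t.2.1.continuous))
  exact continuous_coinduced_dom.2 h

section L2

variable {χ : Representation ℂ Γ V} [MeasurableSpace G]

/-- `Γ^∞(X, E)` regarded as a pre-Hilbert space with the scalar product
`(s, t) = ∫_X ⟨s(x), t(x)⟩_x dx`. -/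
def PreL2 (_m : HermitianMetric 𝔤 χ) (_ν : MeasureTheory.Measure (LeftQuotient Γ)) : Type _ :=
  SmoothSections 𝔤 χ

instance (m : HermitianMetric 𝔤 χ) (ν : MeasureTheory.Measure (LeftQuotient Γ)) :
    AddCommGroup (PreL2 m ν) :=
  inferInstanceAs (AddCommGroup (SmoothSections 𝔤 χ))

namespace PreL2

/-- The module structure of `Γ^∞(X, E)`. -/
@[reducible]
def baseModule (m : HermitianMetric 𝔤 χ) (ν : MeasureTheory.Measure (LeftQuotient Γ)) :
    Module ℂ (PreL2 m ν) :=
  inferInstanceAs (Module ℂ (SmoothSections 𝔤 χ))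

variable (m : HermitianMetric 𝔤 χ) (ν : MeasureTheory.Measure (LeftQuotient Γ))
  [BorelSpace G] [CompactSpace (LeftQuotient Γ)] [MeasureTheory.IsFiniteMeasure ν]

theorem integrable_form (s t : SmoothSections 𝔤 χ) :
    MeasureTheory.Integrable (fun x =>
      m.form x (SmoothSections.toSection s x) (SmoothSections.toSection t x)) ν := by
  have hc := m.continuous_form s t
  obtain ⟨C, hC⟩ := (isCompact_range hc).isBounded.exists_norm_le
  exact MeasureTheory.Integrable.of_bound hc.aestronglyMeasurable C
    (Filter.Eventually.of_forall fun x => hC _ ⟨x, rfl⟩)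

/-- The scalar product `(s, t) = ∫_X ⟨s(x), t(x)⟩_x dx` on `Γ^∞(X, E)`. -/
@[reducible]
def core : letI := baseModule m ν; PreInnerProductSpace.Core ℂ (PreL2 m ν) :=
  letI := baseModule m ν
  { inner := fun s t => ∫ x, m.form x (SmoothSections.toSection (𝔤 := 𝔤) (χ := χ) s x)
      (SmoothSections.toSection (𝔤 := 𝔤) (χ := χ) t x) ∂ν
    conj_inner_symm := fun s t => by
      rw [← integral_conj]
      congr 1; funext x
      induction x using Quotient.inductionOn with | _ g
      exact m.conj_symm g _ _
    re_inner_nonneg := fun s => by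
      have h : (∫ x, m.form x (SmoothSections.toSection (𝔤 := 𝔤) (χ := χ) s x)
          (SmoothSections.toSection (𝔤 := 𝔤) (χ := χ) s x) ∂ν).re =
          ∫ x, (m.form x (SmoothSections.toSection (𝔤 := 𝔤) (χ := χ) s x)
          (SmoothSections.toSection (𝔤 := 𝔤) (χ := χ) s x)).re ∂ν :=
        (integral_re (𝕜 := ℂ) (integrable_form m ν s s)).symm
      change 0 ≤ (∫ x, m.form x (SmoothSections.toSection (𝔤 := 𝔤) (χ := χ) s x)
          (SmoothSections.toSection (𝔤 := 𝔤) (χ := χ) s x) ∂ν).re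
      rw [h]
      refine MeasureTheory.integral_nonneg fun x => ?_
      induction x using Quotient.inductionOn with | _ g
      change 0 ≤ (m.form _ (FlatBundle.pt χ g (s.1 g)) (FlatBundle.pt χ g (s.1 g))).re
      by_cases hv : s.1 g = 0
      · have := m.smul_right g 0 (s.1 g) 0
        rw [hv] at this ⊢
        simp only [smul_zero, zero_mul] at this
        rw [this]; simp
      · exact (m.pos g _ hv).le
    add_left := fun s s' t => by
      refine Eq.trans ?_
        (MeasureTheory.integral_add (integrable_form m ν s t) (integrable_form m ν s' t))
      congr 1; funext x
      induction x using Quotient.inductionOn with | _ g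
      change m.form _ (FlatBundle.pt χ g (s.1 g + s'.1 g)) (FlatBundle.pt χ g (t.1 g)) =
        m.form _ (FlatBundle.pt χ g (s.1 g)) (FlatBundle.pt χ g (t.1 g)) +
        m.form _ (FlatBundle.pt χ g (s'.1 g)) (FlatBundle.pt χ g (t.1 g))
      rw [← m.conj_symm, m.add_right, map_add, m.conj_symm, m.conj_symm]
    smul_left := fun s t c => by
      rw [← MeasureTheory.integral_const_mul]
      congr 1; funext x
      induction x using Quotient.inductionOn with | _ g
      change m.form _ (FlatBundle.pt χ g (c • s.1 g)) (FlatBundle.pt χ g (t.1 g)) =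
        conj c * m.form _ (FlatBundle.pt χ g (s.1 g)) (FlatBundle.pt χ g (t.1 g))
      rw [← m.conj_symm, m.smul_right, map_mul, m.conj_symm] }

instance : SeminormedAddCommGroup (PreL2 m ν) :=
  letI := baseModule m ν
  letI := core m ν
  InnerProductSpace.Core.toSeminormedAddCommGroup (𝕜 := ℂ)

instance : InnerProductSpace ℂ (PreL2 m ν) :=
  letI := baseModule m ν
  InnerProductSpace.ofCore (core m ν)

variable [LieGroup 𝓘(ℝ, 𝔤) ∞ G]

/-- The right regular representation on `Γ^∞(X, E)` with its `L²`-structure. -/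
def rightRegular : Representation ℂ G (PreL2 m ν) := SmoothSections.rightRegular 𝔤 χ

end PreL2

/-- `L²(X, E)`: the completion of `Γ^∞(X, E)` for the `L²`-norm. -/
abbrev L2Sections [BorelSpace G] [CompactSpace (LeftQuotient Γ)]
    (m : HermitianMetric 𝔤 χ) (ν : MeasureTheory.Measure (LeftQuotient Γ))
    [MeasureTheory.IsFiniteMeasure ν] : Type _ :=
  UniformSpace.Completion (PreL2 m ν)

end L2

end Sections

/-! ### Continuous representations, the unitary dual and isotypes -/

/-- A representation `ρ : G → GL(H)` by bounded invertible operators on a Hilbert space is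
continuous if `G × H → H`, `(g, v) ↦ ρ(g) v` is continuous. -/
def IsContinuousRep {G H : Type*} [Group G] [TopologicalSpace G] [NormedAddCommGroup H]
    [InnerProductSpace ℂ H] (ρ : G →* (H →L[ℂ] H)ˣ) : Prop :=
  Continuous fun p : G × H => (ρ p.1 : H →L[ℂ] H) p.2

section Dual

/-- Irreducible unitary (continuous) representations of `K` on Hilbert spaces.  The spaces are
taken in `Type`, where every class of irreducible unitary representations of a compact group has a
representative, as these are finite dimensional. -/
structure IrreducibleUnitaryRep (K : Type*) [Group K] [TopologicalSpace K] where
  space : Type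
  [normedAddCommGroup : NormedAddCommGroup space]
  [innerProductSpace : InnerProductSpace ℂ space]
  [completeSpace : CompleteSpace space]
  rep : K →* unitary (space →L[ℂ] space)
  continuous : Continuous fun p : K × space => (rep p.1 : space →L[ℂ] space) p.2
  nontrivial : Nontrivial space
  irreducible : ∀ U : Submodule ℂ space, IsClosed (U : Set space) →
    (∀ k, ∀ v ∈ U, (rep k : space →L[ℂ] space) v ∈ U) → U = ⊥ ∨ U = ⊤

attribute [instance] IrreducibleUnitaryRep.normedAddCommGroup
  IrreducibleUnitaryRep.innerProductSpace IrreducibleUnitaryRep.completeSpace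

variable (K : Type*) [Group K] [TopologicalSpace K]

/-- Unitary equivalence. -/
def unitaryEquivalence : Setoid (IrreducibleUnitaryRep K) where
  r σ τ := ∃ T : σ.space ≃ₗᵢ[ℂ] τ.space, ∀ k v,
    T ((σ.rep k : σ.space →L[ℂ] σ.space) v) = (τ.rep k : τ.space →L[ℂ] τ.space) (T v)
  iseqv :=
    { refl := fun σ => ⟨LinearIsometryEquiv.refl ℂ _, fun _ _ => rfl⟩
      symm := by
        rintro σ τ ⟨T, hT⟩
        refine ⟨T.symm, fun k v => ?_⟩
        apply T.injective
        rw [hT]; simp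
      trans := by
        rintro ρ σ τ ⟨T, hT⟩ ⟨S, hS⟩
        exact ⟨T.trans S, fun k v => by simp [hT, hS]⟩ }

/-- The unitary dual `K̂`. -/
def UnitaryDual : Type _ := Quotient (unitaryEquivalence K)

variable {K}

/-- The chosen representative `(τ, V_τ)` of a class in `K̂`. -/
def UnitaryDual.representative (τ : UnitaryDual K) : IrreducibleUnitaryRep K :=
  Quotient.out (s := unitaryEquivalence K) τ

/-- The `τ`-isotype `H(τ)` of a representation `π` of `K`: the image of the evaluation map
`V_τ ⊗ Hom_K(V_τ, H) → H`, i.e. the (algebraic) sum of the images of all bounded `K`-equivariant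
maps `V_τ → H`. -/
def isotype {H : Type*} [NormedAddCommGroup H] [InnerProductSpace ℂ H]
    (π : K →* (H →L[ℂ] H)ˣ) (τ : UnitaryDual K) : Submodule ℂ H :=
  ⨆ T : {T : τ.representative.space →L[ℂ] H // ∀ k v,
      T ((τ.representative.rep k : τ.representative.space →L[ℂ] τ.representative.space) v) =
        (π k : H →L[ℂ] H) (T v)},
    LinearMap.range (T.1 : τ.representative.space →ₗ[ℂ] H)

end Dual

end

/-!
The proof has two independent halves.

*The right regular representation on `L²(X, E)`.*  As `X = Γ \ G` is compact, there is a compact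
`C ⊆ G` with `Γ C = G`.  The quotient of the fibre norms at `g` and at `g h` is continuous on the
compact set of all `(g, h, v)` with `g ∈ C`, `h` in a compact neighbourhood and `v` in the unit
sphere of `V`, so it is bounded there; since `dx` is invariant, this bounds `R(h)` for the `L²`-norm
locally uniformly in `h` (`PreL2.exists_norm_rightRegular_le`).  For a fixed section `s`,
`h ↦ R(h) s` is continuous because the translates of `s` converge uniformly on `C`
(`PreL2.continuous_rightRegular_apply`).  Locally bounded families that are continuous on a dense
set of vectors are jointly continuous (`continuous_uncurry_of_locally_bounded`); this is used on
`Γ^∞(X, E)` and again on its completion.  For `k ∈ K` the invariance of the fibre metric makes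
`R(k)` isometric, hence unitary.

*Unitary representations of a compact group on a Hilbert space.*  Averaging a rank-one operator over
the group gives a nonzero compact self-adjoint intertwiner, whose eigenspaces for nonzero eigenvalues
are finite-dimensional and invariant (`IsUnitaryRep.exists_finiteDimensional_invariant`).
Consequently irreducible representations are finite-dimensional, Schur's lemma holds for them,
isotypes of different classes are orthogonal, and a vector orthogonal to all isotypes vanishes, since
it would generate a closed subspace containing an irreducible one (`isHilbertSum_isotype`).  The
isotypes, defined as algebraic sums of images, are closed, because by Schur's lemma evaluation on an
orthonormal basis of `V_τ` embeds a finite power of the complete space of intertwiners with closed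
range (`IsIrreducibleRep.isClosed_iSup_range`).
-/

/-! ### Joint continuity -/

/-- A locally bounded family of bounded operators that depends continuously on the parameter on a
dense set of vectors is jointly continuous. -/
theorem continuous_uncurry_of_locally_bounded {X E F : Type*} [TopologicalSpace X]
    [SeminormedAddCommGroup E] [NormedSpace ℂ E] [SeminormedAddCommGroup F] [NormedSpace ℂ F]
    (f : X → E →L[ℂ] F) (hb : ∀ x₀, ∃ C : ℝ, ∀ᶠ x in nhds x₀, ∀ v, ‖f x v‖ ≤ C * ‖v‖)
    {D : Set E} (hD : Dense D) (hc : ∀ v ∈ D, Continuous fun x => f x v) :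
    Continuous fun p : X × E => f p.1 p.2 := by
  refine continuous_iff_continuousAt.2 ?_
  rintro ⟨x₀, v₀⟩
  obtain ⟨C', hC'⟩ := hb x₀
  obtain ⟨C, hC, hC0⟩ : ∃ C : ℝ, (∀ᶠ x in nhds x₀, ∀ v, ‖f x v‖ ≤ C * ‖v‖) ∧ 0 < C :=
    ⟨max C' 1, hC'.mono fun x hx v => (hx v).trans
      (mul_le_mul_of_nonneg_right (le_max_left _ _) (norm_nonneg _)), by positivity⟩
  refine Metric.tendsto_nhds.2 fun ε hε => ?_
  have hδ : 0 < ε / (4 * C) := by positivity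
  obtain ⟨w, hw, hwD⟩ := Metric.dense_iff.1 hD v₀ _ hδ
  have h1 : ∀ᶠ x in nhds x₀, dist (f x w) (f x₀ w) < ε / 4 :=
    Metric.tendsto_nhds.1 ((hc w hwD).tendsto x₀) _ (by positivity)
  have h2 : ∀ᶠ v in nhds v₀, dist v v₀ < ε / (4 * C) := Metric.ball_mem_nhds _ hδ
  filter_upwards [(hC.and h1).prod_nhds h2]
  rintro ⟨x, v⟩ ⟨⟨hx, hxw⟩, hv⟩
  have hwv : ‖w - v₀‖ < ε / (4 * C) := by rwa [Metric.mem_ball, dist_eq_norm] at hw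
  have hCε : C * (ε / (4 * C)) = ε / 4 := by field_simp
  rw [dist_eq_norm] at hxw hv ⊢
  have e : f x v - f x₀ v₀ =
      f x (v - v₀) - f x (w - v₀) + (f x w - f x₀ w) + f x₀ (w - v₀) := by
    simp only [map_sub]; abel
  have b1 := (hx (v - v₀)).trans_lt (mul_lt_mul_of_pos_left hv hC0)
  have b2 := (hx (w - v₀)).trans_lt (mul_lt_mul_of_pos_left hwv hC0)
  have b3 := (hC.self_of_nhds (w - v₀)).trans_lt (mul_lt_mul_of_pos_left hwv hC0)
  have n1 := norm_sub_le (f x (v - v₀)) (f x (w - v₀))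
  have n2 := norm_add_le (f x (v - v₀) - f x (w - v₀)) (f x w - f x₀ w)
  have n3 := norm_add_le (f x (v - v₀) - f x (w - v₀) + (f x w - f x₀ w)) (f x₀ (w - v₀))
  rw [← e] at n3
  linarith

/-! ### Unitary representations of compact groups -/

section UnitaryRep

open MeasureTheory InnerProductSpace

variable {K : Type*} [Group K] [TopologicalSpace K]
  {H : Type*} [NormedAddCommGroup H] [InnerProductSpace ℂ H]
  {E : Type*} [NormedAddCommGroup E] [InnerProductSpace ℂ E]
  {E' : Type*} [NormedAddCommGroup E'] [InnerProductSpace ℂ E']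

/-- A strongly continuous unitary representation of `K`, written as a homomorphism into the monoid
of bounded operators that preserves the scalar product. -/
structure IsUnitaryRep (ρ : K →* (H →L[ℂ] H)) : Prop where
  continuous_apply : ∀ v, Continuous fun k => ρ k v
  inner_map : ∀ k v w, inner ℂ (ρ k v) (ρ k w) = inner ℂ v w

/-- `K`-equivariance of a bounded operator. -/
def IsIntertwiner (σ : K →* (E →L[ℂ] E)) (ρ : K →* (H →L[ℂ] H)) (T : E →L[ℂ] H) : Prop :=
  ∀ k v, T (σ k v) = ρ k (T v)

/-- Topological irreducibility: there are no closed invariant subspaces but the two trivial ones. -/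
structure IsIrreducibleRep (ρ : K →* (H →L[ℂ] H)) : Prop where
  nontrivial : Nontrivial H
  eq_bot_or_eq_top : ∀ U : Submodule ℂ H, IsClosed (U : Set H) →
    (∀ k, ∀ v ∈ U, ρ k v ∈ U) → U = ⊥ ∨ U = ⊤

namespace IsUnitaryRep

variable {ρ : K →* (H →L[ℂ] H)} {σ : K →* (E →L[ℂ] E)} {σ' : K →* (E' →L[ℂ] E')}

omit [TopologicalSpace K] in
theorem _root_.MonoidHom.apply_inv_apply_self (ρ : K →* (H →L[ℂ] H)) (k : K) (v : H) :
    ρ k (ρ k⁻¹ v) = v := by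
  have h : ρ k * ρ k⁻¹ = 1 := by rw [← map_mul, mul_inv_cancel, map_one]
  exact congrArg (fun A : H →L[ℂ] H => A v) h

theorem inner_map_left (hρ : IsUnitaryRep ρ) (k : K) (v w : H) :
    inner ℂ (ρ k v) w = inner ℂ v (ρ k⁻¹ w) := by
  rw [← hρ.inner_map k v, ρ.apply_inv_apply_self]

theorem norm_map (hρ : IsUnitaryRep ρ) (k : K) (v : H) : ‖ρ k v‖ = ‖v‖ := by
  rw [@norm_eq_sqrt_re_inner ℂ, hρ.inner_map, ← @norm_eq_sqrt_re_inner ℂ]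

theorem continuous_uncurry (hρ : IsUnitaryRep ρ) : Continuous fun p : K × H => ρ p.1 p.2 :=
  continuous_uncurry_of_locally_bounded (fun k => ρ k)
    (fun _ => ⟨1, Filter.Eventually.of_forall fun k v => by rw [hρ.norm_map, one_mul]⟩)
    dense_univ fun v _ => hρ.continuous_apply v

theorem adjoint_eq [CompleteSpace H] (hρ : IsUnitaryRep ρ) (k : K) :
    ContinuousLinearMap.adjoint (ρ k) = ρ k⁻¹ := by
  symm
  rw [ContinuousLinearMap.eq_adjoint_iff]
  intro v w
  rw [hρ.inner_map_left, inv_inv]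

theorem mem_unitary [CompleteSpace H] (hρ : IsUnitaryRep ρ) (k : K) :
    ρ k ∈ unitary (H →L[ℂ] H) := by
  rw [Unitary.mem_iff, ContinuousLinearMap.star_eq_adjoint, hρ.adjoint_eq, ← map_mul, ← map_mul]
  simp

theorem of_mem_unitary [CompleteSpace H] (hc : ∀ v, Continuous fun k => ρ k v)
    (h : ∀ k, ρ k ∈ unitary (H →L[ℂ] H)) : IsUnitaryRep ρ where
  continuous_apply := hc
  inner_map k v w := by
    have h1 := (Unitary.mem_iff.1 (h k)).1
    rw [ContinuousLinearMap.star_eq_adjoint] at h1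
    rw [← ContinuousLinearMap.adjoint_inner_right]
    exact congrArg (fun A : H →L[ℂ] H => inner ℂ v (A w)) h1

omit [TopologicalSpace K] in
/-- The eigenspaces of an operator commuting with `K` are invariant. -/
theorem _root_.IsIntertwiner.eigenspace_invariant {A : H →L[ℂ] H} (hA : IsIntertwiner ρ ρ A)
    (c : ℂ) (k : K) {v : H} (hv : v ∈ Module.End.eigenspace (A : H →ₗ[ℂ] H) c) :
    ρ k v ∈ Module.End.eigenspace (A : H →ₗ[ℂ] H) c := by
  rw [Module.End.mem_eigenspace_iff] at hv ⊢
  change A v = c • v at hv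
  change A (ρ k v) = c • ρ k v
  rw [hA, hv, map_smul]

/-- Every nonzero vector `v` produces a nonzero finite-dimensional invariant subspace, which is
moreover contained in the closed invariant subspace generated by `v`.  It is an eigenspace of the
average over `K` of the rank-one operators `⟨ρ(k)v, ·⟩ ρ(k)v`, a nonzero compact self-adjoint
operator that commutes with `K`. -/
theorem exists_finiteDimensional_invariant [CompleteSpace H] [IsTopologicalGroup K]
    [CompactSpace K] (hρ : IsUnitaryRep ρ) {v : H} (hv : v ≠ 0) :
    ∃ W : Submodule ℂ H, W ≠ ⊥ ∧ FiniteDimensional ℂ W ∧ (∀ k, ∀ w ∈ W, ρ k w ∈ W) ∧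
      ∀ y, (∀ k, inner ℂ (ρ k v) y = 0) → ∀ w ∈ W, inner ℂ w y = 0 := by
  borelize K
  let μ : Measure K := Measure.haarMeasure ⊤
  have : IsProbabilityMeasure μ := ⟨Measure.haarMeasure_self⟩
  let F : K → H →L[ℂ] H := fun k => rankOne ℂ (ρ k v) (ρ k v)
  have hFc : Continuous F :=
    (ContinuousLinearMap.smulRightL ℂ H H).continuous₂.comp
      (((innerSL ℂ).continuous.comp (hρ.continuous_apply v)).prodMk (hρ.continuous_apply v))
  have hFi : Integrable F μ := hFc.integrable_of_hasCompactSupport (.of_compactSpace F)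
  let A : H →L[ℂ] H := ∫ k, F k ∂μ
  have hFy : ∀ x, Integrable (fun k => F k x) μ := fun x =>
    (ContinuousLinearMap.apply ℂ H x).integrable_comp hFi
  have hAx : ∀ x, A x = ∫ k, F k x ∂μ := fun x => ContinuousLinearMap.integral_apply hFi x
  have hAi : ∀ x y, inner ℂ y (A x) =
      ∫ k, inner ℂ (ρ k v) x * inner ℂ y (ρ k v) ∂μ := by
    intro x y
    rw [hAx, ← integral_inner (hFy x)]
    simp only [F, rankOne_apply, inner_smul_right]
  have hAcpt : IsCompactOperator A := by
    refine Convex.integral_mem (s := {T : H →L[ℂ] H | IsCompactOperator T}) ?_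
      isClosed_setOfPred_isCompactOperator (Filter.Eventually.of_forall fun k => ?_) hFi
    · exact ((compactOperator (RingHom.id ℂ) H H).restrictScalars ℝ).convex
    · exact (isCompactOperator_of_locallyCompactSpace_rng
        (ContinuousLinearMap.toSpanSingleton ℂ (ρ k v))).comp_clm (innerSL ℂ (ρ k v))
  have hAsymm : (A : H →ₗ[ℂ] H).IsSymmetric := by
    intro x y
    change inner ℂ (A x) y = inner ℂ x (A y)
    rw [← inner_conj_symm, hAi, hAi, ← integral_conj]
    congr 1; funext k
    simp only [map_mul, inner_conj_symm]
    ring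
  have hAK : IsIntertwiner ρ ρ A := by
    intro h x
    refine ext_inner_left ℂ fun y => ?_
    -- Substitute `h k` for `k` in the average.
    rw [← inner_conj_symm y (ρ h (A x)), hρ.inner_map_left, inner_conj_symm, hAi, hAi,
      ← integral_mul_left_eq_self _ h]
    congr 1; funext k
    rw [map_mul, mul_apply_eq_comp, hρ.inner_map, hρ.inner_map_left h⁻¹, inv_inv]
  have hA0 : A ≠ 0 := by
    intro h0
    have h1 : ∀ k, inner ℂ (ρ k v) v * inner ℂ v (ρ k v) =
        ((‖inner ℂ v (ρ k v)‖ ^ 2 : ℝ) : ℂ) := fun k => by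
      rw [← inner_conj_symm, ← Complex.normSq_eq_conj_mul_self, Complex.normSq_eq_norm_sq]
    have hc : Continuous fun k => ‖inner ℂ v (ρ k v)‖ ^ 2 :=
      ((continuous_const.inner (hρ.continuous_apply v)).norm).pow 2
    -- The integrand of `⟨v, A v⟩` is continuous, nonnegative and positive at `k = 1`.
    have h2 : 0 < ∫ k, ‖inner ℂ v (ρ k v)‖ ^ 2 ∂μ :=
      hc.integral_pos_of_hasCompactSupport_nonneg_nonzero (.of_compactSpace _)
        (fun k => sq_nonneg _) (x := 1) (by simpa using hv)
    have h3 := hAi v v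
    simp only [h1, h0, integral_complex_ofReal, zero_apply,
      inner_zero_right] at h3
    exact h2.ne' (Complex.ofReal_eq_zero.1 h3.symm)
  have hex : ∃ c : ℂ, Module.End.HasEigenvalue (A : H →ₗ[ℂ] H) c ∧ c ≠ 0 := by
    by_contra! hcon
    exact hA0 ((ContinuousLinearMap.eq_zero_of_forall_hasEigenvalue_eq_zero hAcpt hAsymm).1 hcon)
  obtain ⟨c, hc, hc0⟩ := hex
  refine ⟨Module.End.eigenspace (A : H →ₗ[ℂ] H) c, hc,
    ContinuousLinearMap.finite_dimensional_eigenspace hAcpt c hc0,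
    fun k w hw => hAK.eigenspace_invariant c k hw, fun y hy w hw => ?_⟩
  rw [Module.End.mem_eigenspace_iff] at hw
  change A w = c • w at hw
  have h1 : inner ℂ y (A w) = 0 := by
    rw [hAi]
    refine (integral_congr_ae (Filter.Eventually.of_forall fun k => ?_)).trans (integral_zero _ _)
    simp [inner_eq_zero_symm.1 (hy k)]
  rw [hw, inner_smul_right, mul_eq_zero] at h1
  exact inner_eq_zero_symm.1 (h1.resolve_left hc0)

end IsUnitaryRep

end UnitaryRep

section UnitaryRep

open MeasureTheory InnerProductSpace

variable {K : Type*} [Group K] [TopologicalSpace K]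
  {H : Type*} [NormedAddCommGroup H] [InnerProductSpace ℂ H]
  {E : Type*} [NormedAddCommGroup E] [InnerProductSpace ℂ E]
  {E' : Type*} [NormedAddCommGroup E'] [InnerProductSpace ℂ E']
  {ρ : K →* (H →L[ℂ] H)} {σ : K →* (E →L[ℂ] E)} {σ' : K →* (E' →L[ℂ] E')}

/-! ### Schur's lemma -/

/-- Irreducible unitary representations of compact groups are finite-dimensional. -/
theorem IsIrreducibleRep.finiteDimensional [CompleteSpace E] [IsTopologicalGroup K]
    [CompactSpace K] (hi : IsIrreducibleRep σ) (hσ : IsUnitaryRep σ) : FiniteDimensional ℂ E := by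
  have := hi.nontrivial
  obtain ⟨v, hv⟩ := exists_ne (0 : E)
  obtain ⟨W, hW0, hWf, hWi, -⟩ := hσ.exists_finiteDimensional_invariant hv
  have hW : W = ⊤ := (hi.eq_bot_or_eq_top W W.closed_of_finiteDimensional hWi).resolve_left hW0
  subst hW
  exact Module.finite_def.2 (Module.Finite.iff_fg.1 hWf)

omit [TopologicalSpace K] in
/-- Schur's lemma for endomorphisms. -/
theorem IsIrreducibleRep.exists_eq_smul [FiniteDimensional ℂ E] (hi : IsIrreducibleRep σ)
    {A : E →L[ℂ] E} (hA : IsIntertwiner σ σ A) : ∃ c : ℂ, ∀ v, A v = c • v := by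
  have := hi.nontrivial
  obtain ⟨c, hc⟩ := Module.End.exists_eigenvalue (A : E →ₗ[ℂ] E)
  have h := (hi.eq_bot_or_eq_top _ (Submodule.closed_of_finiteDimensional _)
    (fun k v hv => hA.eigenspace_invariant c k hv)).resolve_left hc
  refine ⟨c, fun v => ?_⟩
  have hv : v ∈ Module.End.eigenspace (A : E →ₗ[ℂ] E) c := h ▸ Submodule.mem_top
  exact Module.End.mem_eigenspace_iff.1 hv

theorem IsIntertwiner.adjoint_comp [CompleteSpace H] [CompleteSpace E] [CompleteSpace E']
    (hρ : IsUnitaryRep ρ) (hσ' : IsUnitaryRep σ')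
    {T : E →L[ℂ] H} {S : E' →L[ℂ] H} (hT : IsIntertwiner σ ρ T) (hS : IsIntertwiner σ' ρ S) :
    IsIntertwiner σ σ' (ContinuousLinearMap.adjoint S ∘L T) := by
  intro k v
  refine ext_inner_left ℂ fun w => ?_
  simp only [ContinuousLinearMap.comp_apply]
  rw [ContinuousLinearMap.adjoint_inner_right, hT, ← inner_conj_symm w, hσ'.inner_map_left,
    inner_conj_symm, ContinuousLinearMap.adjoint_inner_right, hS, ← inner_conj_symm,
    hρ.inner_map_left, inner_conj_symm]

/-- Two intertwiners out of the same irreducible representation differ by a scalar factor as far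
as scalar products are concerned. -/
theorem IsIrreducibleRep.exists_inner_eq [CompleteSpace H] [FiniteDimensional ℂ E]
    (hi : IsIrreducibleRep σ) (hσ : IsUnitaryRep σ) (hρ : IsUnitaryRep ρ)
    {S T : E →L[ℂ] H} (hS : IsIntertwiner σ ρ S) (hT : IsIntertwiner σ ρ T) :
    ∃ c : ℂ, ∀ v w, inner ℂ (S v) (T w) = c * inner ℂ v w := by
  have := FiniteDimensional.complete ℂ E
  obtain ⟨c, hc⟩ := hi.exists_eq_smul (hT.adjoint_comp hρ hσ hS)
  refine ⟨c, fun v w => ?_⟩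
  rw [← ContinuousLinearMap.adjoint_inner_right, ← inner_smul_right, ← hc]
  rfl

/-- An intertwiner out of an irreducible representation is a multiple of an isometry. -/
theorem IsIrreducibleRep.norm_apply_eq [CompleteSpace H] [FiniteDimensional ℂ E]
    (hi : IsIrreducibleRep σ) (hσ : IsUnitaryRep σ) (hρ : IsUnitaryRep ρ)
    {T : E →L[ℂ] H} (hT : IsIntertwiner σ ρ T) (v : E) : ‖T v‖ = ‖T‖ * ‖v‖ := by
  have := hi.nontrivial
  obtain ⟨c, hc⟩ := hi.exists_inner_eq hσ hρ hT hT
  have h1 : ∀ w, ‖T w‖ = √‖c‖ * ‖w‖ := fun w => by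
    have h2 := congrArg norm (hc w w)
    rw [norm_mul, inner_self_eq_norm_sq_to_K, inner_self_eq_norm_sq_to_K, norm_pow, norm_pow] at h2
    simp only [RCLike.norm_ofReal, abs_norm] at h2
    rw [← Real.sqrt_sq (norm_nonneg (T w)), h2, Real.sqrt_mul (norm_nonneg c),
      Real.sqrt_sq (norm_nonneg w)]
  have h3 : ‖T‖ = √‖c‖ := by
    apply ContinuousLinearMap.opNorm_eq_of_bounds (Real.sqrt_nonneg _) (fun w => (h1 w).le)
    intro N _ hN
    obtain ⟨w, hw⟩ := exists_ne (0 : E)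
    have h4 := hN w
    rw [h1] at h4
    exact le_of_mul_le_mul_right h4 (norm_pos_iff.2 hw)
  rw [h1, h3]

/-- Schur's lemma for two irreducible representations: a nonzero intertwiner, suitably rescaled,
is a unitary equivalence. -/
theorem IsIrreducibleRep.exists_linearIsometryEquiv [FiniteDimensional ℂ E] [CompleteSpace E']
    (hi : IsIrreducibleRep σ) (hσ : IsUnitaryRep σ) (hi' : IsIrreducibleRep σ')
    (hσ' : IsUnitaryRep σ') {A : E →L[ℂ] E'} (hA : IsIntertwiner σ σ' A) (hA0 : A ≠ 0) :
    ∃ U : E ≃ₗᵢ[ℂ] E', ∀ k v, U (σ k v) = σ' k (U v) := by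
  have hn : ‖A‖ ≠ 0 := norm_ne_zero_iff.2 hA0
  let U₀ : E →ₗᵢ[ℂ] E' :=
    { toLinearMap := ((‖A‖⁻¹ : ℂ) • A : E →L[ℂ] E')
      norm_map' := fun v => by
        change ‖(‖A‖⁻¹ : ℂ) • A v‖ = ‖v‖
        rw [norm_smul, hi.norm_apply_eq hσ hσ' hA, norm_inv, Complex.norm_real, norm_norm,
          inv_mul_cancel_left₀ hn] }
  have hU₀ : ∀ v, U₀ v = (‖A‖⁻¹ : ℂ) • A v := fun v => rfl
  have hint : ∀ k v, U₀ (σ k v) = σ' k (U₀ v) := fun k v => by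
    rw [hU₀, hU₀, hA, map_smul]
  have hrange : LinearMap.range U₀.toLinearMap = ⊤ := by
    refine (hi'.eq_bot_or_eq_top _ (Submodule.closed_of_finiteDimensional _) ?_).resolve_left ?_
    · rintro k _ ⟨v, rfl⟩
      exact ⟨σ k v, hint k v⟩
    · intro h0
      have := hi.nontrivial
      obtain ⟨v, hv⟩ := exists_ne (0 : E)
      have h1 : U₀ v ∈ LinearMap.range U₀.toLinearMap := ⟨v, rfl⟩
      rw [h0, Submodule.mem_bot] at h1
      exact hv (U₀.injective (by rw [h1, map_zero]))
  exact ⟨LinearIsometryEquiv.ofSurjective U₀ (LinearMap.range_eq_top.1 hrange), hint⟩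

/-! ### Irreducible subrepresentations -/

omit [TopologicalSpace K] in
/-- A nonzero finite-dimensional invariant subspace contains a minimal one. -/
theorem exists_minimal_invariant {W : Submodule ℂ H} (hW0 : W ≠ ⊥) [FiniteDimensional ℂ W]
    (hWi : ∀ k, ∀ w ∈ W, ρ k w ∈ W) :
    ∃ U : Submodule ℂ H, U ≤ W ∧ U ≠ ⊥ ∧ FiniteDimensional ℂ U ∧ (∀ k, ∀ w ∈ U, ρ k w ∈ U) ∧
      ∀ U' ≤ U, (∀ k, ∀ w ∈ U', ρ k w ∈ U') → U' = ⊥ ∨ U' = U := by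
  classical
  have hex : ∃ n : ℕ, ∃ U : Submodule ℂ H, U ≤ W ∧ U ≠ ⊥ ∧ (∀ k, ∀ w ∈ U, ρ k w ∈ U) ∧
      Module.finrank ℂ U = n := ⟨_, W, le_rfl, hW0, hWi, rfl⟩
  obtain ⟨U, hUW, hU0, hUi, hUn⟩ := Nat.find_spec hex
  have hUf : FiniteDimensional ℂ U := Submodule.finiteDimensional_of_le hUW
  refine ⟨U, hUW, hU0, hUf, hUi, fun U' hU' hU'i => ?_⟩
  by_contra! hcon
  have hlt : U' < U := lt_of_le_of_ne hU' hcon.2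
  have h1 := Submodule.finrank_lt_finrank_of_lt hlt
  rw [hUn] at h1
  exact Nat.find_min hex h1 ⟨U', hU'.trans hUW, hcon.1, hU'i, rfl⟩

/-- The homomorphism into bounded operators underlying an irreducible unitary representation. -/
noncomputable def IrreducibleUnitaryRep.toHom (σ : IrreducibleUnitaryRep K) :
    K →* (σ.space →L[ℂ] σ.space) :=
  (unitary (σ.space →L[ℂ] σ.space)).subtype.comp σ.rep

theorem IrreducibleUnitaryRep.isUnitaryRep (σ : IrreducibleUnitaryRep K) :
    IsUnitaryRep σ.toHom :=
  .of_mem_unitary (fun _ => σ.continuous.comp (continuous_id.prodMk continuous_const))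
    fun k => (σ.rep k).2

theorem IrreducibleUnitaryRep.isIrreducibleRep (σ : IrreducibleUnitaryRep K) :
    IsIrreducibleRep σ.toHom :=
  ⟨σ.nontrivial, σ.irreducible⟩

/-- A minimal finite-dimensional invariant subspace of a unitary representation is the range of an
intertwiner from an irreducible unitary representation on some `ℂⁿ`. -/
theorem IsUnitaryRep.exists_irreducible_range_eq (hρ : IsUnitaryRep ρ) {U : Submodule ℂ H}
    (hU0 : U ≠ ⊥) [FiniteDimensional ℂ U] (hUi : ∀ k, ∀ w ∈ U, ρ k w ∈ U)
    (hmin : ∀ U' ≤ U, (∀ k, ∀ w ∈ U', ρ k w ∈ U') → U' = ⊥ ∨ U' = U) :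
    ∃ (σ : IrreducibleUnitaryRep K) (T : σ.space →L[ℂ] H),
      IsIntertwiner σ.toHom ρ T ∧ LinearMap.range (T : σ.space →ₗ[ℂ] H) = U := by
  let e : U ≃ₗᵢ[ℂ] EuclideanSpace ℂ (Fin (Module.finrank ℂ U)) := (stdOrthonormalBasis ℂ U).repr
  let J : EuclideanSpace ℂ (Fin (Module.finrank ℂ U)) →ₗᵢ[ℂ] H :=
    U.subtypeₗᵢ.comp e.symm.toLinearIsometry
  have hJU : ∀ v, J v ∈ U := fun v => (e.symm v).2
  have hJe : ∀ u : U, J (e u) = u := fun u => congrArg Subtype.val (e.symm_apply_apply u)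
  let r : K → EuclideanSpace ℂ (Fin (Module.finrank ℂ U)) →L[ℂ]
      EuclideanSpace ℂ (Fin (Module.finrank ℂ U)) := fun k =>
    e.toContinuousLinearEquiv.toContinuousLinearMap ∘L
      ((ρ k ∘L J.toContinuousLinearMap).codRestrict U fun v => hUi k _ (hJU v))
  have hJr : ∀ k v, J (r k v) = ρ k (J v) := fun k v => hJe ⟨ρ k (J v), hUi k _ (hJU v)⟩
  let rep : K →* (EuclideanSpace ℂ (Fin (Module.finrank ℂ U)) →L[ℂ]
      EuclideanSpace ℂ (Fin (Module.finrank ℂ U))) :=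
    { toFun := r
      map_one' := by
        ext1 v
        apply J.injective
        rw [hJr, map_one]; rfl
      map_mul' := fun k l => by
        ext1 v
        apply J.injective
        rw [hJr, map_mul]
        change ρ k (ρ l (J v)) = J (r k (r l v))
        rw [hJr, hJr] }
  have hrep : ∀ k v, J (rep k v) = ρ k (J v) := hJr
  have hrepu : IsUnitaryRep rep :=
    { continuous_apply := fun v => by
        refine J.isometry.isEmbedding.continuous_iff.2 ?_
        exact (hρ.continuous_apply (J v)).congr fun k => (hrep k v).symm
      inner_map := fun k v w => by
        rw [← J.inner_map_map, hrep, hrep, hρ.inner_map, J.inner_map_map] }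
  have hJrange : LinearMap.range J.toLinearMap = U := by
    apply le_antisymm
    · rintro _ ⟨v, rfl⟩; exact hJU v
    · intro u hu; exact ⟨e ⟨u, hu⟩, hJe ⟨u, hu⟩⟩
  refine ⟨{ space := EuclideanSpace ℂ (Fin (Module.finrank ℂ U))
            rep := rep.codRestrict (unitary _) hrepu.mem_unitary
            continuous := ?_
            nontrivial := ?_
            irreducible := ?_ }, J.toContinuousLinearMap, hrep, hJrange⟩
  · exact hrepu.continuous_uncurry
  · have : Nontrivial U := Submodule.nontrivial_iff_ne_bot.2 hU0
    exact e.symm.toEquiv.nontrivial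
  · intro W _ hWi
    have hmap : ∀ W' : Submodule ℂ _, W.map J.toLinearMap = W'.map J.toLinearMap → W = W' :=
      fun W' h => Submodule.map_injective_of_injective J.injective h
    rcases hmin (W.map J.toLinearMap) (by rintro _ ⟨v, -, rfl⟩; exact hJU v) (by
      rintro k _ ⟨v, hv, rfl⟩
      exact ⟨rep k v, hWi k v hv, hrep k v⟩) with h | h
    · exact Or.inl (hmap ⊥ (by rw [h, Submodule.map_bot]))
    · exact Or.inr (hmap ⊤ (by rw [h, Submodule.map_top, hJrange]))

end UnitaryRep

/-! ### Isotypes -/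

section Isotype

open MeasureTheory InnerProductSpace

variable {K : Type*} [Group K] [TopologicalSpace K]
  {H : Type*} [NormedAddCommGroup H] [InnerProductSpace ℂ H]
  {E : Type*} [NormedAddCommGroup E] [InnerProductSpace ℂ E]

/-- The closed subspace `Hom_K(E, H)` of the space of bounded operators. -/
def intertwiners (σ : K →* (E →L[ℂ] E)) (ρ : K →* (H →L[ℂ] H)) : Submodule ℂ (E →L[ℂ] H) where
  carrier := {T | IsIntertwiner σ ρ T}
  add_mem' hS hT k v := by simp [hS k v, hT k v]
  zero_mem' k v := by simp
  smul_mem' c T hT k v := by simp [hT k v]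

omit [TopologicalSpace K] in
theorem isClosed_intertwiners (σ : K →* (E →L[ℂ] E)) (ρ : K →* (H →L[ℂ] H)) :
    IsClosed (intertwiners σ ρ : Set (E →L[ℂ] H)) := by
  have h : (intertwiners σ ρ : Set (E →L[ℂ] H)) =
      ⋂ (k : K) (v : E), {T | T (σ k v) = ρ k (T v)} := by
    ext T
    simp only [Set.mem_iInter]
    rfl
  rw [h]
  exact isClosed_iInter fun k => isClosed_iInter fun v =>
    isClosed_eq (by fun_prop) (by fun_prop)

/-- The algebraic sum of the images of all intertwiners out of an irreducible representation is
closed: evaluation on an orthonormal basis of `E` identifies it with a finite power of the complete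
space `Hom_K(E, H)`, because by Schur's lemma the images of different basis vectors under any two
intertwiners are orthogonal. -/
theorem IsIrreducibleRep.isClosed_iSup_range [CompleteSpace H] [FiniteDimensional ℂ E]
    {σ : K →* (E →L[ℂ] E)} {ρ : K →* (H →L[ℂ] H)}
    (hi : IsIrreducibleRep σ) (hσ : IsUnitaryRep σ) (hρ : IsUnitaryRep ρ) :
    IsClosed ((⨆ T : intertwiners σ ρ, LinearMap.range (T.1 : E →ₗ[ℂ] H) : Submodule ℂ H) :
      Set H) := by
  have : CompleteSpace (intertwiners σ ρ) := (isClosed_intertwiners σ ρ).completeSpace_coe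
  let b := stdOrthonormalBasis ℂ E
  let Φ : (Fin (Module.finrank ℂ E) → intertwiners σ ρ) →ₗ[ℂ] H :=
    { toFun := fun T => ∑ j, (T j).1 (b j)
      map_add' := fun S T => by simp [Finset.sum_add_distrib]
      map_smul' := fun c T => by simp [Finset.smul_sum] }
  have hΦ : ∀ T, Φ T = ∑ j, (T j).1 (b j) := fun T => rfl
  have hΦc : Continuous Φ := by
    change Continuous fun T : Fin (Module.finrank ℂ E) → intertwiners σ ρ => ∑ j, (T j).1 (b j)
    fun_prop
  have hbound : ∀ T, ‖T‖ ≤ (1 : NNReal) * ‖Φ T‖ := by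
    intro T
    rw [NNReal.coe_one, one_mul, pi_norm_le_iff_of_nonneg (norm_nonneg _)]
    intro j
    have h1 : ‖(T j).1 (b j)‖ = ‖T j‖ := by
      rw [hi.norm_apply_eq hσ hρ (T j).2, b.norm_eq_one, mul_one]; rfl
    have h2 : inner ℂ ((T j).1 (b j)) (Φ T) = inner ℂ ((T j).1 (b j)) ((T j).1 (b j)) := by
      rw [hΦ, inner_sum]
      refine Finset.sum_eq_single j (fun i _ hij => ?_) (by simp)
      obtain ⟨c, hc⟩ := hi.exists_inner_eq hσ hρ (T j).2 (T i).2
      rw [hc, b.inner_eq_zero hij.symm, mul_zero]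
    have h3 : ‖(T j).1 (b j)‖ * ‖(T j).1 (b j)‖ ≤ ‖(T j).1 (b j)‖ * ‖Φ T‖ := by
      calc _ = ‖inner ℂ ((T j).1 (b j)) ((T j).1 (b j))‖ := by
            simp [inner_self_eq_norm_sq_to_K, sq]
        _ ≤ _ := h2 ▸ norm_inner_le_norm _ _
    rw [← h1]
    rcases (norm_nonneg ((T j).1 (b j))).eq_or_lt with h0 | h0
    · rw [← h0]; exact norm_nonneg _
    · exact le_of_mul_le_mul_left h3 h0
  have hrange : LinearMap.range Φ = ⨆ T : intertwiners σ ρ, LinearMap.range (T.1 : E →ₗ[ℂ] H) := by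
    apply le_antisymm
    · rintro _ ⟨T, rfl⟩
      rw [hΦ]
      exact Submodule.sum_mem _ fun j _ =>
        Submodule.mem_iSup_of_mem
          (p := fun T : intertwiners σ ρ => LinearMap.range (T.1 : E →ₗ[ℂ] H)) (T j) ⟨b j, rfl⟩
    · refine iSup_le fun T => ?_
      rintro _ ⟨v, rfl⟩
      refine ⟨fun j => inner ℂ (b j) v • T, ?_⟩
      rw [hΦ]
      conv_rhs => rw [← b.sum_repr' v]
      simp
  rw [← hrange, LinearMap.coe_range]
  exact (AddMonoidHomClass.antilipschitz_of_bound Φ hbound).isClosed_range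
    (uniformContinuous_addMonoidHom_of_continuous hΦc)

variable {π : K →* (H →L[ℂ] H)ˣ}

theorem isotype_eq_iSup (τ : UnitaryDual K) :
    isotype π τ = ⨆ T : intertwiners τ.representative.toHom ((Units.coeHom _).comp π),
      LinearMap.range (T.1 : τ.representative.space →ₗ[ℂ] H) := rfl

theorem isClosed_isotype [CompleteSpace H] [IsTopologicalGroup K] [CompactSpace K]
    (hρ : IsUnitaryRep ((Units.coeHom _).comp π)) (τ : UnitaryDual K) :
    IsClosed (isotype π τ : Set H) := by
  have := τ.representative.isIrreducibleRep.finiteDimensional τ.representative.isUnitaryRep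
  rw [isotype_eq_iSup]
  exact τ.representative.isIrreducibleRep.isClosed_iSup_range τ.representative.isUnitaryRep hρ

theorem inner_eq_zero_of_mem_isotype [CompleteSpace H] [IsTopologicalGroup K] [CompactSpace K]
    (hρ : IsUnitaryRep ((Units.coeHom _).comp π)) {τ τ' : UnitaryDual K} (hne : τ ≠ τ')
    {v w : H} (hv : v ∈ isotype π τ) (hw : w ∈ isotype π τ') : inner ℂ v w = 0 := by
  have hf := τ.representative.isIrreducibleRep.finiteDimensional τ.representative.isUnitaryRep
  have hf' := τ'.representative.isIrreducibleRep.finiteDimensional τ'.representative.isUnitaryRep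
  suffices h : isotype π τ ⟂ isotype π τ' from h.inner_eq hv hw
  rw [isotype_eq_iSup, isotype_eq_iSup, Submodule.isOrtho_iSup_left]
  intro S
  rw [Submodule.isOrtho_iSup_right]
  intro T
  rw [Submodule.isOrtho_iff_inner_eq]
  rintro _ ⟨x, rfl⟩ _ ⟨y, rfl⟩
  have hA := IsIntertwiner.adjoint_comp hρ τ.representative.isUnitaryRep T.2 S.2
  by_contra hxy
  have hA0 : ContinuousLinearMap.adjoint S.1 ∘L T.1 ≠ 0 := by
    intro h0
    apply hxy
    change inner ℂ (S.1 x) (T.1 y) = 0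
    rw [← ContinuousLinearMap.adjoint_inner_right]
    change inner ℂ x ((ContinuousLinearMap.adjoint S.1 ∘L T.1) y) = 0
    rw [h0, zero_apply, inner_zero_right]
  obtain ⟨U, hU⟩ := τ'.representative.isIrreducibleRep.exists_linearIsometryEquiv
    τ'.representative.isUnitaryRep τ.representative.isIrreducibleRep
    τ.representative.isUnitaryRep hA hA0
  apply hne
  rw [← Quotient.out_eq (s := unitaryEquivalence K) τ,
    ← Quotient.out_eq (s := unitaryEquivalence K) τ']
  exact (Quotient.sound (s := unitaryEquivalence K) ⟨U, hU⟩).symm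

/-- The range of an intertwiner from any irreducible unitary representation lies in the isotype of
its class. -/
theorem range_le_isotype (σ : IrreducibleUnitaryRep K) {T : σ.space →L[ℂ] H}
    (hT : IsIntertwiner σ.toHom ((Units.coeHom _).comp π) T) :
    LinearMap.range (T : σ.space →ₗ[ℂ] H) ≤
      isotype π (Quotient.mk (unitaryEquivalence K) σ) := by
  obtain ⟨U, hU⟩ := Quotient.mk_out (s := unitaryEquivalence K) σ
  let τ : UnitaryDual K := Quotient.mk (unitaryEquivalence K) σ
  let U' : τ.representative.space ≃ₗᵢ[ℂ] σ.space := U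
  rintro _ ⟨v, rfl⟩
  refine Submodule.mem_iSup_of_mem (p := fun T : intertwiners τ.representative.toHom
    ((Units.coeHom _).comp π) => LinearMap.range (T.1 : τ.representative.space →ₗ[ℂ] H))
    ⟨T ∘L U'.toContinuousLinearEquiv.toContinuousLinearMap, fun k w => ?_⟩
    ⟨U'.symm v, congrArg T (U'.apply_symm_apply v)⟩
  exact (congrArg T (hU k w)).trans (hT k (U' w))

/-- Every unitary representation of a compact group is the Hilbert sum of its isotypes: a vector
orthogonal to all of them would generate a subspace containing an irreducible one. -/
theorem isHilbertSum_isotype [CompleteSpace H] [IsTopologicalGroup K] [CompactSpace K]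
    (hρ : IsUnitaryRep ((Units.coeHom _).comp π)) :
    IsHilbertSum ℂ (fun τ : UnitaryDual K => isotype π τ)
      (fun τ => (isotype π τ).subtypeₗᵢ) := by
  have (τ : UnitaryDual K) : CompleteSpace (isotype π τ) :=
    (isClosed_isotype hρ τ).completeSpace_coe
  refine IsHilbertSum.mkInternal (F := fun τ => isotype π τ) (fun τ τ' hne v w =>
    inner_eq_zero_of_mem_isotype hρ hne v.2 w.2) ?_
  rw [top_le_iff, Submodule.topologicalClosure_eq_top_iff, Submodule.eq_bot_iff]
  intro v hv
  by_contra hv0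
  obtain ⟨W, hW0, hWf, hWi, hWv⟩ := hρ.exists_finiteDimensional_invariant hv0
  obtain ⟨U, hUW, hU0, hUf, hUi, hmin⟩ := exists_minimal_invariant hW0 hWi
  obtain ⟨σ, T, hT, hTU⟩ := hρ.exists_irreducible_range_eq hU0 hUi hmin
  have hUτ := range_le_isotype σ hT
  rw [hTU] at hUτ
  obtain ⟨u, hu, hu0⟩ := Submodule.exists_mem_ne_zero_of_ne_bot hU0
  refine hu0 (inner_self_eq_zero (𝕜 := ℂ).1 (hWv u (fun k => ?_) u (hUW hu)))
  -- `U` is invariant and contained in an isotype, so `ρ(k)⁻¹ u` is orthogonal to `v`.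
  rw [hρ.inner_map_left]
  exact Submodule.inner_left_of_mem_orthogonal
    (Submodule.mem_iSup_of_mem _ (hUτ (hUi k⁻¹ u hu))) hv

end Isotype

/-! ### The compact quotient -/

section QuotientSpace

variable {G : Type*} [Group G] {Γ : Subgroup G}

/-- A compact quotient is covered by a compact subset of the group. -/
theorem LeftQuotient.exists_isCompact_proj_surjOn [TopologicalSpace G] [IsTopologicalGroup G]
    [LocallyCompactSpace G] [CompactSpace (LeftQuotient Γ)] :
    ∃ C : Set G, IsCompact C ∧ ∀ x : LeftQuotient Γ, ∃ c ∈ C, LeftQuotient.proj Γ c = x := by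
  have hopen : IsOpenMap (LeftQuotient.proj Γ) := isOpenMap_quotient_mk'_mul
  have hsurj : Function.Surjective (LeftQuotient.proj Γ) := Quotient.mk_surjective
  choose N hNc hN using fun g : G => exists_compact_mem_nhds g
  choose g hg using hsurj
  obtain ⟨t, -, ht⟩ := isCompact_univ.elim_nhds_subcover
    (fun x : LeftQuotient Γ => LeftQuotient.proj Γ '' N (g x)) fun x _ => by
      have h := hopen.image_mem_nhds (hN (g x))
      rwa [hg] at h
  refine ⟨⋃ x ∈ t, N (g x), t.finite_toSet.isCompact_biUnion fun x _ => hNc _, fun x => ?_⟩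
  obtain ⟨y, hy, c, hc, rfl⟩ := Set.mem_iUnion₂.1 (ht (Set.mem_univ x))
  exact ⟨c, Set.mem_biUnion hy hc, rfl⟩

theorem LeftQuotient.measurable_translate [MeasurableSpace G] [TopologicalSpace G]
    [IsTopologicalGroup G] [BorelSpace G] (h : G) :
    Measurable (LeftQuotient.translate h : LeftQuotient Γ → LeftQuotient Γ) := by
  have h1 : Measurable (LeftQuotient.proj Γ) := fun _ hs => hs
  exact measurable_from_quotient.2 (h1.comp (continuous_mul_const h).measurable)

end QuotientSpace

/-! ### The norm of the fibre metric -/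

section Metric

open SmoothSections

variable {𝔤 G V : Type*} [NormedAddCommGroup 𝔤] [NormedSpace ℝ 𝔤]
  [TopologicalSpace G] [ChartedSpace 𝔤 G] [Group G]
  [NormedAddCommGroup V] [NormedSpace ℂ V] {Γ : Subgroup G} {χ : Representation ℂ Γ V}

namespace HermitianMetric

variable (m : HermitianMetric 𝔤 χ)

/-- The quadratic form `v ↦ ⟨Γ(g, v), Γ(g, v)⟩` of a fibre metric in the trivialization at `g`. -/
noncomputable def normSq (g : G) (v : V) : ℝ :=
  (m.form _ (FlatBundle.pt χ g v) (FlatBundle.pt χ g v)).re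

theorem continuous_normSq : Continuous fun p : G × V => m.normSq p.1 p.2 :=
  Complex.continuous_re.comp (m.smooth.continuous.comp
    (continuous_fst.prodMk (continuous_snd.prodMk continuous_snd)))

theorem normSq_smul (g : G) (c : ℂ) (v : V) : m.normSq g (c • v) = ‖c‖ ^ 2 * m.normSq g v := by
  unfold normSq
  rw [m.smul_right, ← m.conj_symm, m.smul_right, map_mul, m.conj_symm, ← mul_assoc,
    Complex.mul_conj, Complex.normSq_eq_norm_sq, Complex.re_ofReal_mul]

theorem normSq_zero (g : G) : m.normSq g 0 = 0 := by
  simpa using m.normSq_smul g 0 0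

/-- On compact sets the norms at `g` and at `g h` are comparable, with uniform constants. -/
theorem exists_normSq_le [IsTopologicalGroup G] [FiniteDimensional ℂ V] {C Ω : Set G}
    (hC : IsCompact C) (hΩ : IsCompact Ω) :
    ∃ M : ℝ, 0 ≤ M ∧ ∀ g ∈ C, ∀ h ∈ Ω, ∀ v, m.normSq g v ≤ M * m.normSq (g * h) v := by
  have : ProperSpace V := FiniteDimensional.proper ℂ V
  have hS : IsCompact (C ×ˢ Ω ×ˢ Metric.sphere (0 : V) 1) :=
    hC.prod (hΩ.prod (isCompact_sphere 0 1))
  have hpos : ∀ p : G × G × V, p ∈ C ×ˢ Ω ×ˢ Metric.sphere (0 : V) 1 →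
      0 < m.normSq (p.1 * p.2.1) p.2.2 := fun p hp =>
    m.pos _ _ (by
      rintro h0
      have h1 : ‖p.2.2‖ = 1 := mem_sphere_zero_iff_norm.1 hp.2.2
      rw [h0, norm_zero] at h1
      exact zero_ne_one h1)
  have hcont : ContinuousOn
      (fun p : G × G × V => m.normSq p.1 p.2.2 / m.normSq (p.1 * p.2.1) p.2.2)
      (C ×ˢ Ω ×ˢ Metric.sphere (0 : V) 1) := by
    refine ContinuousOn.div (Continuous.continuousOn ?_) (Continuous.continuousOn ?_)
      fun p hp => (hpos p hp).ne'
    · exact m.continuous_normSq.comp (continuous_fst.prodMk continuous_snd.snd)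
    · exact m.continuous_normSq.comp
        ((continuous_fst.mul continuous_snd.fst).prodMk continuous_snd.snd)
  obtain ⟨M, hM⟩ := hS.exists_bound_of_continuousOn hcont
  refine ⟨max M 0, le_max_right _ _, fun g hg h hh v => ?_⟩
  by_cases hv : v = 0
  · rw [hv, m.normSq_zero, m.normSq_zero, mul_zero]
  -- By homogeneity it suffices to compare unit vectors.
  have hv' : ‖v‖ ≠ 0 := norm_ne_zero_iff.2 hv
  obtain ⟨u, hu, hvu⟩ : ∃ u : V, ‖u‖ = 1 ∧ v = (‖v‖ : ℂ) • u :=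
    ⟨(‖v‖⁻¹ : ℂ) • v,
      by rw [norm_smul, norm_inv, Complex.norm_real, norm_norm, inv_mul_cancel₀ hv'],
      by rw [smul_smul, mul_inv_cancel₀ (by exact_mod_cast hv'), one_smul]⟩
  have hmem : (g, h, u) ∈ C ×ˢ Ω ×ˢ Metric.sphere (0 : V) 1 :=
    ⟨hg, hh, mem_sphere_zero_iff_norm.2 hu⟩
  have h1 : m.normSq g u ≤ max M 0 * m.normSq (g * h) u := by
    rw [← div_le_iff₀ (hpos _ hmem)]
    exact ((Real.le_norm_self _).trans (hM _ hmem)).trans (le_max_left _ _)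
  rw [hvu, m.normSq_smul, m.normSq_smul, mul_left_comm]
  exact mul_le_mul_of_nonneg_left h1 (sq_nonneg _)

end HermitianMetric

variable [MeasurableSpace G] [BorelSpace G] [CompactSpace (LeftQuotient Γ)]
  (m : HermitianMetric 𝔤 χ) (ν : MeasureTheory.Measure (LeftQuotient Γ))
  [MeasureTheory.IsFiniteMeasure ν]

namespace PreL2

theorem inner_def (s t : PreL2 m ν) :
    inner ℂ s t = ∫ x, m.form x (toSection (𝔤 := 𝔤) (χ := χ) s x)
      (toSection (𝔤 := 𝔤) (χ := χ) t x) ∂ν := rfl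

theorem norm_sq_eq (s : PreL2 m ν) :
    ‖s‖ ^ 2 = ∫ x, (m.form x (toSection (𝔤 := 𝔤) (χ := χ) s x)
      (toSection (𝔤 := 𝔤) (χ := χ) s x)).re ∂ν := by
  rw [@norm_sq_eq_re_inner ℂ, inner_def]
  exact (integral_re (𝕜 := ℂ) (integrable_form m ν s s)).symm

end PreL2

/-! ### Boundedness and continuity of the right regular representation -/

variable [LieGroup 𝓘(ℝ, 𝔤) ∞ G] [IsTopologicalGroup G]

omit [CompactSpace (LeftQuotient Γ)] [MeasureTheory.IsFiniteMeasure ν] in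
variable {ν} in
theorem integral_comp_translate {F : Type*} [NormedAddCommGroup F] [NormedSpace ℝ F]
    (hν : ∀ h : G, ν.map (LeftQuotient.translate h) = ν) {φ : LeftQuotient Γ → F}
    (hφ : MeasureTheory.AEStronglyMeasurable φ ν) (h : G) :
    ∫ x, φ (LeftQuotient.translate h x) ∂ν = ∫ x, φ x ∂ν := by
  conv_rhs => rw [← hν h]
  rw [MeasureTheory.integral_map (LeftQuotient.measurable_translate h).aemeasurable]
  rwa [hν h]

namespace PreL2

/-- The operators `R(h)` are bounded for the `L²`-norm, locally uniformly in `h`: by compactness of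
`X` the fibre norms at `x` and `x h` are comparable, and the measure is invariant. -/
theorem exists_norm_rightRegular_le [LocallyCompactSpace G] [FiniteDimensional ℂ V]
    (hν : ∀ h : G, ν.map (LeftQuotient.translate h) = ν) (h₀ : G) :
    ∃ M : ℝ, 0 ≤ M ∧ ∀ᶠ h in nhds h₀, ∀ s : PreL2 m ν, ‖rightRegular m ν h s‖ ≤ M * ‖s‖ := by
  obtain ⟨C, hC, hCX⟩ := LeftQuotient.exists_isCompact_proj_surjOn (Γ := Γ)
  obtain ⟨Ω, hΩ, hΩ₀⟩ := exists_compact_mem_nhds h₀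
  obtain ⟨M, hM0, hM⟩ := m.exists_normSq_le hC hΩ
  refine ⟨√M, Real.sqrt_nonneg _, Filter.mem_of_superset hΩ₀ fun h hh s => ?_⟩
  have hi : MeasureTheory.Integrable (fun x => (m.form x (toSection (𝔤 := 𝔤) (χ := χ) s x)
      (toSection (𝔤 := 𝔤) (χ := χ) s x)).re) ν := (integrable_form m ν s s).re
  have hi' : MeasureTheory.Integrable (fun x =>
      (m.form x (toSection (rightRegular m ν h s : SmoothSections 𝔤 χ) x)
        (toSection (rightRegular m ν h s : SmoothSections 𝔤 χ) x)).re) ν :=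
    (integrable_form m ν _ _).re
  have hit := (hν h).symm ▸ hi
  have hit' := hit.comp_measurable (LeftQuotient.measurable_translate h)
  have key : ‖rightRegular m ν h s‖ ^ 2 ≤ M * ‖s‖ ^ 2 := by
    rw [norm_sq_eq, norm_sq_eq, ← integral_comp_translate hν hi.aestronglyMeasurable h,
      ← MeasureTheory.integral_const_mul]
    refine MeasureTheory.integral_mono hi' (hit'.const_mul M) fun x => ?_
    obtain ⟨c, hc, rfl⟩ := hCX x
    exact hM c hc h hh _
  calc ‖rightRegular m ν h s‖ = √(‖rightRegular m ν h s‖ ^ 2) :=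
        (Real.sqrt_sq (norm_nonneg _)).symm
    _ ≤ √(M * ‖s‖ ^ 2) := Real.sqrt_le_sqrt key
    _ = √M * ‖s‖ := by rw [Real.sqrt_mul hM0, Real.sqrt_sq (norm_nonneg _)]

/-- Orbit maps are continuous for the `L²`-norm: translates of a section by nearby elements are
uniformly close on a compact set covering `X`. -/
theorem continuous_rightRegular_apply [LocallyCompactSpace G] (s : PreL2 m ν) :
    Continuous fun h : G => rightRegular m ν h s := by
  obtain ⟨C, hC, hCX⟩ := LeftQuotient.exists_isCompact_proj_surjOn (Γ := Γ)
  let f : G → V := (show SmoothSections 𝔤 χ from s).1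
  have hf : Continuous f := (show SmoothSections 𝔤 χ from s).2.1.continuous
  refine continuous_iff_continuousAt.2 fun h₀ => Metric.tendsto_nhds.2 fun ε hε => ?_
  -- A pointwise bound by `δ` bounds the squared `L²`-distance by `ν(X) δ < ε²`.
  obtain ⟨δ, hδ, hδε⟩ : ∃ δ : ℝ, 0 < δ ∧ ν.real Set.univ * δ < ε ^ 2 := by
    refine ⟨ε ^ 2 / (ν.real Set.univ + 1), by positivity, ?_⟩
    rw [← mul_div_assoc, div_lt_iff₀ (by positivity), mul_comm]
    nlinarith [sq_pos_of_pos hε]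
  have hcont : Continuous fun p : G × G => m.normSq p.2 (f (p.2 * p.1) - f (p.2 * h₀)) :=
    m.continuous_normSq.comp (continuous_snd.prodMk
      ((hf.comp (continuous_snd.mul continuous_fst)).sub
        (hf.comp (continuous_snd.mul continuous_const))))
  have hev : ∀ᶠ h in nhds h₀, ∀ c ∈ C, m.normSq c (f (c * h) - f (c * h₀)) < δ := by
    refine hC.eventually_forall_of_forall_eventually fun c _ => ?_
    refine (hcont.tendsto (h₀, c)).eventually (gt_mem_nhds ?_)
    simpa [m.normSq_zero] using hδ
  filter_upwards [hev] with h hh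
  rw [dist_eq_norm]
  refine lt_of_pow_lt_pow_left₀ 2 hε.le (lt_of_le_of_lt ?_ hδε)
  rw [norm_sq_eq, ← smul_eq_mul, ← MeasureTheory.integral_const]
  refine MeasureTheory.integral_mono (integrable_form m ν _ _).re
    (MeasureTheory.integrable_const δ) fun x => ?_
  obtain ⟨c, hc, rfl⟩ := hCX x
  exact (hh c hc).le

/-- For `k` in a subgroup leaving the fibre metric invariant, `R(k)` preserves the scalar
product. -/
theorem inner_rightRegular {K : Subgroup G} (hm : m.IsInvariant K)
    (hν : ∀ h : G, ν.map (LeftQuotient.translate h) = ν) {k : G} (hk : k ∈ K) (s t : PreL2 m ν) :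
    inner ℂ (rightRegular m ν k s) (rightRegular m ν k t) = inner ℂ s t := by
  rw [inner_def, inner_def,
    ← integral_comp_translate hν (integrable_form m ν s t).aestronglyMeasurable k]
  congr 1; funext x
  induction x using Quotient.inductionOn with | _ g
  exact (hm g k hk _ _).symm

variable [LocallyCompactSpace G] [FiniteDimensional ℂ V]

variable {ν} in
/-- The bounded operator `R(h)` on `Γ^∞(X, E)` with the `L²`-norm. -/
noncomputable def rightRegularCLM (hν : ∀ h : G, ν.map (LeftQuotient.translate h) = ν) (h : G) :
    PreL2 m ν →L[ℂ] PreL2 m ν :=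
  LinearMap.mkContinuousOfExistsBound (rightRegular m ν h)
    (let ⟨M, _, hM⟩ := exists_norm_rightRegular_le m ν hν h; ⟨M, hM.self_of_nhds⟩)

variable (hν : ∀ h : G, ν.map (LeftQuotient.translate h) = ν)

theorem rightRegularCLM_apply (h : G) (s : PreL2 m ν) :
    rightRegularCLM m hν h s = rightRegular m ν h s := rfl

include hν in
theorem continuous_rightRegular :
    Continuous fun p : G × PreL2 m ν => rightRegular m ν p.1 p.2 :=
  continuous_uncurry_of_locally_bounded (rightRegularCLM m hν)
    (fun h => let ⟨M, _, hM⟩ := exists_norm_rightRegular_le m ν hν h; ⟨M, hM⟩)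
    dense_univ fun s _ => continuous_rightRegular_apply m ν s

end PreL2

/-! ### The representation on `L²(X, E)` -/

namespace L2Sections

open PreL2 UniformSpace

variable [LocallyCompactSpace G] [FiniteDimensional ℂ V]
  {ν} (hν : ∀ h : G, ν.map (LeftQuotient.translate h) = ν)

/-- The right regular representation on `L²(X, E)`, with values in the monoid of bounded
operators. -/
noncomputable def rightRegularHom : G →* (L2Sections m ν →L[ℂ] L2Sections m ν) where
  toFun h := (rightRegularCLM m hν h).completion
  map_one' := by
    ext u
    induction u using Completion.induction_on with
    | hp => exact isClosed_eq (by fun_prop) (by fun_prop)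
    | ih s =>
      rw [ContinuousLinearMap.completion_apply_coe, rightRegularCLM_apply, map_one]; rfl
  map_mul' h h' := by
    ext u
    induction u using Completion.induction_on with
    | hp => exact isClosed_eq (by fun_prop) (by fun_prop)
    | ih s =>
      rw [mul_apply_eq_comp]
      simp only [ContinuousLinearMap.completion_apply_coe, rightRegularCLM_apply, map_mul]
      rfl

theorem rightRegularHom_coe (h : G) (s : PreL2 m ν) :
    rightRegularHom m hν h (s : L2Sections m ν) = (rightRegular m ν h s : PreL2 m ν) :=
  ContinuousLinearMap.completion_apply_coe _ s

theorem continuous_rightRegularHom :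
    Continuous fun p : G × L2Sections m ν => rightRegularHom m hν p.1 p.2 := by
  refine continuous_uncurry_of_locally_bounded (rightRegularHom m hν) (fun h₀ => ?_)
    (Completion.denseRange_coe (α := PreL2 m ν)) ?_
  · obtain ⟨M, _, hM⟩ := exists_norm_rightRegular_le m ν hν h₀
    refine ⟨M, hM.mono fun h hh u => ?_⟩
    induction u using Completion.induction_on with
    | hp => exact isClosed_le (by fun_prop) (by fun_prop)
    | ih s =>
      rw [rightRegularHom_coe, Completion.norm_coe, Completion.norm_coe]
      exact hh s
  · rintro _ ⟨s, rfl⟩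
    simp only [rightRegularHom_coe]
    exact (Completion.continuous_coe _).comp (continuous_rightRegular_apply m ν s)

theorem inner_rightRegularHom {K : Subgroup G} (hm : m.IsInvariant K) {k : G} (hk : k ∈ K)
    (u v : L2Sections m ν) :
    inner ℂ (rightRegularHom m hν k u) (rightRegularHom m hν k v) = inner ℂ u v := by
  induction u, v using Completion.induction_on₂ with
  | hp => exact isClosed_eq (by fun_prop) (by fun_prop)
  | ih s t =>
    rw [rightRegularHom_coe, rightRegularHom_coe, Completion.inner_coe, Completion.inner_coe]
    exact inner_rightRegular m ν hm hν hk s t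

theorem isUnitaryRep_rightRegularHom {K : Subgroup G} (hm : m.IsInvariant K) :
    IsUnitaryRep ((rightRegularHom m hν).comp K.subtype) := by
  refine ⟨fun u => ?_, fun k u v => ?_⟩
  · have h := (continuous_rightRegularHom m hν).comp
      (continuous_subtype_val.prodMk continuous_const : Continuous fun k : K => ((k : G), u))
    exact h
  · exact inner_rightRegularHom m hν hm k.2 u v

end L2Sections

end Metric

/-! ### Continuity, unitarity on `K` and the isotypic decomposition -/

theorem mainTheorem7
    {𝔤 G V : Type*} [NormedAddCommGroup 𝔤] [NormedSpace ℝ 𝔤] [FiniteDimensional ℝ 𝔤]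
    [TopologicalSpace G] [T2Space G] [SecondCountableTopology G] [ConnectedSpace G]
    [ChartedSpace 𝔤 G] [Group G] [LieGroup 𝓘(ℝ, 𝔤) ∞ G]
    (hG : IsSemisimpleLieGroup 𝔤 G) (hcenter : Finite (Subgroup.center G))
    (K : Subgroup G) (hK : IsMaximalCompactSubgroup K)
    (Γ : Subgroup G) [DiscreteTopology Γ] [CompactSpace (LeftQuotient Γ)]
    (htorsion : ∀ γ : Γ, IsOfFinOrder γ → γ = 1)
    [MeasurableSpace G] [BorelSpace G]
    (μ : MeasureTheory.Measure G) [μ.IsHaarMeasure]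
    (ν : MeasureTheory.Measure (LeftQuotient Γ)) [MeasureTheory.IsFiniteMeasure ν]
    (hν : IsQuotientMeasure Γ μ ν)
    [NormedAddCommGroup V] [NormedSpace ℂ V] [FiniteDimensional ℂ V]
    (χ : Representation ℂ Γ V)
    (m : HermitianMetric 𝔤 χ) (hm : m.IsInvariant K) :
    Continuous (fun p : G × PreL2 m ν => PreL2.rightRegular m ν p.1 p.2) ∧
    ∃ R : G →* (L2Sections m ν →L[ℂ] L2Sections m ν)ˣ,
      IsContinuousRep R ∧
      (∀ (g : G) (f : PreL2 m ν),
        (R g : L2Sections m ν →L[ℂ] L2Sections m ν) (f : L2Sections m ν) =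
          (PreL2.rightRegular m ν g f : PreL2 m ν)) ∧
      (∀ k ∈ K, (R k : L2Sections m ν →L[ℂ] L2Sections m ν) ∈
        unitary (L2Sections m ν →L[ℂ] L2Sections m ν)) ∧
      (∀ τ : UnitaryDual K,
        IsClosed (isotype (R.comp K.subtype) τ : Set (L2Sections m ν))) ∧
      IsHilbertSum ℂ (fun τ : UnitaryDual K => isotype (R.comp K.subtype) τ)
        (fun τ => (isotype (R.comp K.subtype) τ).subtypeₗᵢ) := by
  have : IsTopologicalGroup G := topologicalGroup_of_lieGroup 𝓘(ℝ, 𝔤) ∞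
  have : LocallyCompactSpace G := Manifold.locallyCompact_of_finiteDimensional 𝓘(ℝ, 𝔤)
  have : CompactSpace K := isCompact_iff_compactSpace.1 hK.prop
  have hu := L2Sections.isUnitaryRep_rightRegularHom m hν.invariant hm
  refine ⟨PreL2.continuous_rightRegular m ν hν.invariant,
    (L2Sections.rightRegularHom m hν.invariant).toHomUnits,
    L2Sections.continuous_rightRegularHom m hν.invariant,
    L2Sections.rightRegularHom_coe m hν.invariant, fun k hk => hu.mem_unitary ⟨k, hk⟩,
    fun τ => isClosed_isotype hu τ, isHilbertSum_isotype hu⟩
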